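/- Let $m\ge 1$ and let $B,A_{-1},A_0,A_1$ be real $m\times m$ matrices such that the block tridiagonal matrix $$P=\begin{bmatrix}B&A_1\\ A_{-1}&A_0&A_1\\ &A_{-1}&A_0&\ddots\\ &&\ddots&\ddots\end{bmatrix}$$ is row-stochastic, i.e. the transition matrix of a Quasi-Birth-and-Death (QBD) Markov chain on $\mathbb N\times\{1,\dots,m\}$. Assume that $P$ and $A_{-1}+A_0+A_1$ are irreducible, and that the doubly infinite QBD on $\mathbb Z\times\{1,\dots,m\}$ (transitions $A_{-1},A_0,A_1$ one level down, on the same level, one level up) has only one final class, that this class is $\mathbb Z\times\mathcal E_*$ for a nonempty $\mathcal E_*\subseteq\{1,\dots,m\}$, and that every other state is on a path to it. Assume that the QBD $P$ is not null recurrent, i.e. that it is positive recurrent or transient. Let $G$ and $\widehat G$ be the (entrywise) minimal nonnegative solutions of $$A_{-1}+(A_0-I)X+A_1X^2=0\qquad\text{and}\qquad A_1+(A_0-I)X+A_{-1}X^2=0$$ respectively. Let $0\le p\le m$, and let $M=[\,L\mid K\,]$ be a nonsingular complex $m\times m$ matrix, with $L$ of size $m\times p$ and $K$ of size $m\times(m-p)$,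 such that $$\widehat G M=M\begin{bmatrix}V_1&0\\0&V_0\end{bmatrix},$$ where $V_1$ is a nonsingular $p\times p$ matrix and $V_0$ is an $(m-p)\times(m-p)$ matrix with spectral radius $\rho(V_0)=0$. Put $$X=[X_1\mid X_2],\quad X_1=[\,I_m\mid L\,],\quad X_2=K,\qquad T=\mathrm{diag}(T_1,T_2),\quad T_1=\mathrm{diag}(G,V_1^{-1}),\quad T_2=V_0 .$$ Then $(X,T)$ is a decomposable pair of the matrix polynomial $\eta(\lambda)=A_{-1}+(A_0-I)\lambda+A_1\lambda^2$, with $X_1,T_1$ of sizes $m\times(m+p)$, $(m+p)\times(m+p)$. Here, for an $m\times m$ matrix polynomial $Q(\lambda)=\sum_{i=0}^{l}Q_i\lambda^i$ of degree $l$, a pair $(X,T)$ of matrices of sizes $m\times ml$ and $ml\times ml$ is called a decomposable pair if, for some $0\le q\le ml$: (i) $X=[X_1\mid X_2]$ and $T=\mathrm{diag}(T_1,T_2)$ with $X_1$ of size $m\times q$ and $T_1$ of size $q\times q$; (ii) the $ml\times ml$ matrix $$\begin{bmatrix}X_1&X_2T_2^{l-1}\\ X_1T_1&X_2T_2^{l-2}\\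 \vdots&\vdots\\ X_1T_1^{l-1}&X_2\end{bmatrix}$$ is nonsingular; (iii) $\sum_{i=0}^{l}Q_iX_1T_1^{i}=0$ and $\sum_{i=0}^{l}Q_iX_2T_2^{\,l-i}=0$. -/

import Mathlib

open scoped ENNReal Polynomial

namespace QBD

noncomputable section

/-! ### Markov chains on a state space `S`, given by a transition matrix -/

/-- `P` has nonnegative entries and every row sums to one. -/
def IsRowStochastic {S : Type*} (P : Matrix S S ℝ) : Prop :=
  (∀ x y, 0 ≤ P x y) ∧ ∀ x, HasSum (fun y => P x y) 1

/-- `y` can be reached from `x` in finitely many (possibly zero) steps. -/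
def Reaches {S : Type*} (P : Matrix S S ℝ) (x y : S) : Prop :=
  Relation.ReflTransGen (fun a b => 0 < P a b) x y

/-- A final class: a nonempty set of states that communicate with each other and that cannot be
left. -/
def IsFinalClass {S : Type*} (P : Matrix S S ℝ) (C : Set S) : Prop :=
  C.Nonempty ∧ (∀ x ∈ C, ∀ y ∈ C, Reaches P x y) ∧ ∀ x ∈ C, ∀ y, 0 < P x y → y ∈ C

/-- `firstPassage P y n x` is the probability that the chain started in `x` visits `y` at time `n`
for the first time after time `0`. -/
def firstPassage {S : Type*} (P : Matrix S S ℝ) (y : S) : ℕ → S → ℝ≥0∞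
  | 0, _ => 0
  | 1, x => ENNReal.ofReal (P x y)
  | n + 2, x => ∑' z : {z : S // z ≠ y}, ENNReal.ofReal (P x z) * firstPassage P y (n + 1) z

/-- The probability that the chain started in `x` ever returns to `x`. -/
def returnProb {S : Type*} (P : Matrix S S ℝ) (x : S) : ℝ≥0∞ :=
  ∑' n, firstPassage P x n x

/-- The expected return time to `x` (used for states to which the return is certain). -/
def meanReturnTime {S : Type*} (P : Matrix S S ℝ) (x : S) : ℝ≥0∞ :=
  ∑' n : ℕ, (n : ℝ≥0∞) * firstPassage P x n x

/-- Every state is transient. -/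
def IsTransient {S : Type*} (P : Matrix S S ℝ) : Prop :=
  ∀ x, returnProb P x < 1

/-- Every state is recurrent, with a finite expected return time. -/
def IsPositiveRecurrent {S : Type*} (P : Matrix S S ℝ) : Prop :=
  ∀ x, returnProb P x = 1 ∧ meanReturnTime P x < ∞

/-! ### Quasi-birth-and-death processes

`Am`, `A0`, `A1` are the blocks `A₋₁`, `A₀`, `A₁`; states are pairs (level, phase). -/

/-- The transition matrix of the QBD on the levels `0, 1, 2, …`. -/
def transition {m : ℕ} (B Am A0 A1 : Matrix (Fin m) (Fin m) ℝ) :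
    Matrix (ℕ × Fin m) (ℕ × Fin m) ℝ :=
  Matrix.of fun x y =>
    if y.1 = x.1 + 1 then A1 x.2 y.2
    else if y.1 = x.1 then (if x.1 = 0 then B x.2 y.2 else A0 x.2 y.2)
    else if y.1 + 1 = x.1 then Am x.2 y.2
    else 0

/-- The transition matrix of the doubly infinite QBD, on the levels in `ℤ`. -/
def doublyInfinite {m : ℕ} (Am A0 A1 : Matrix (Fin m) (Fin m) ℝ) :
    Matrix (ℤ × Fin m) (ℤ × Fin m) ℝ :=
  Matrix.of fun x y =>
    if y.1 = x.1 + 1 then A1 x.2 y.2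
    else if y.1 = x.1 then A0 x.2 y.2
    else if y.1 + 1 = x.1 then Am x.2 y.2
    else 0

/-- The doubly infinite QBD has exactly one final class; it is of the form `ℤ × E` with
`E` nonempty, and every state is on a path to it. -/
def HasOneFinalClass {m : ℕ} (Am A0 A1 : Matrix (Fin m) (Fin m) ℝ) : Prop :=
  ∃ E : Set (Fin m), E.Nonempty ∧
    (∀ C, IsFinalClass (doublyInfinite Am A0 A1) C ↔ C = {x | x.2 ∈ E}) ∧
    ∀ x, ∃ y, y.2 ∈ E ∧ Reaches (doublyInfinite Am A0 A1) x y

/-- The standing assumptions on a QBD. -/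
def IsQBD {m : ℕ} (B Am A0 A1 : Matrix (Fin m) (Fin m) ℝ) : Prop :=
  IsRowStochastic (transition B Am A0 A1) ∧
  (transition B Am A0 A1).IsIrreducible ∧
  (Am + A0 + A1).IsIrreducible ∧
  HasOneFinalClass Am A0 A1

/-- `G` is the (entrywise) minimal nonnegative solution of `C₀ + (C₁ - I) X + C₂ X² = 0`. -/
def IsMinNonnegSol {m : ℕ} (C₀ C₁ C₂ G : Matrix (Fin m) (Fin m) ℝ) : Prop :=
  (∀ i j, 0 ≤ G i j) ∧ C₀ + (C₁ - 1) * G + C₂ * G ^ 2 = 0 ∧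
  ∀ X : Matrix (Fin m) (Fin m) ℝ, (∀ i j, 0 ≤ X i j) →
    C₀ + (C₁ - 1) * X + C₂ * X ^ 2 = 0 → ∀ i j, G i j ≤ X i j

/-- A real matrix, regarded as a complex one. -/
def toComplex {m : ℕ} (A : Matrix (Fin m) (Fin m) ℝ) : Matrix (Fin m) (Fin m) ℂ :=
  A.map Complex.ofReal

/-- The matrix polynomial `η(λ) = A₋₁ + (A₀ - I) λ + A₁ λ²`. -/
def eta {m : ℕ} (Am A0 A1 : Matrix (Fin m) (Fin m) ℝ) : (Matrix (Fin m) (Fin m) ℂ)[X] :=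
  Polynomial.C (toComplex Am) + Polynomial.C (toComplex A0 - 1) * Polynomial.X +
    Polynomial.C (toComplex A1) * Polynomial.X ^ 2

/-! ### Decomposable pairs -/

/-- Nonsingularity of a square matrix whose rows and columns are indexed by different types. -/
def IsNonsingular {ι κ : Type*} [Fintype ι] [Fintype κ] [DecidableEq ι] [DecidableEq κ]
    (M : Matrix ι κ ℂ) : Prop :=
  ∃ N : Matrix κ ι ℂ, M * N = 1 ∧ N * M = 1

/-- The matrix whose `i`-th block row, `i = 0, …, l - 1`, is `[X₁ T₁ⁱ | X₂ T₂ˡ⁻¹⁻ⁱ]`. -/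
def pairMatrix {m : ℕ} {ι₁ ι₂ : Type*} [Fintype ι₁] [DecidableEq ι₁] [Fintype ι₂] [DecidableEq ι₂]
    (l : ℕ) (X₁ : Matrix (Fin m) ι₁ ℂ) (T₁ : Matrix ι₁ ι₁ ℂ) (X₂ : Matrix (Fin m) ι₂ ℂ)
    (T₂ : Matrix ι₂ ι₂ ℂ) : Matrix (Fin l × Fin m) (ι₁ ⊕ ι₂) ℂ :=
  Matrix.of fun x =>
    Sum.elim ((X₁ * T₁ ^ (x.1 : ℕ)) x.2) ((X₂ * T₂ ^ (l - 1 - (x.1 : ℕ))) x.2)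

/-- `(X, T)` is a decomposable pair for the `m × m` matrix polynomial `Q` of degree `l`, with
respect to the partition `ι₁ ⊕ ι₂` of the `m l` indices of `T`. -/
def IsDecomposablePair {m : ℕ} {ι₁ ι₂ : Type*} [Fintype ι₁] [DecidableEq ι₁]
    [Fintype ι₂] [DecidableEq ι₂] (l : ℕ) (Q : (Matrix (Fin m) (Fin m) ℂ)[X])
    (X : Matrix (Fin m) (ι₁ ⊕ ι₂) ℂ) (T : Matrix (ι₁ ⊕ ι₂) (ι₁ ⊕ ι₂) ℂ) : Prop :=
  Q.degree = l ∧
  Fintype.card ι₁ + Fintype.card ι₂ = m * l ∧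
  ∃ (X₁ : Matrix (Fin m) ι₁ ℂ) (X₂ : Matrix (Fin m) ι₂ ℂ)
    (T₁ : Matrix ι₁ ι₁ ℂ) (T₂ : Matrix ι₂ ι₂ ℂ),
    X = Matrix.fromCols X₁ X₂ ∧ T = Matrix.fromBlocks T₁ 0 0 T₂ ∧
    IsNonsingular (pairMatrix l X₁ T₁ X₂ T₂) ∧
    ∑ i ∈ Finset.range (l + 1), Q.coeff i * X₁ * T₁ ^ i = 0 ∧
    ∑ i ∈ Finset.range (l + 1), Q.coeff i * X₂ * T₂ ^ (l - i) = 0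

end

end QBD

namespace QBD

open Filter Topology Matrix

/-! The two residual equations are algebra: the one for `[I | L]` comes from the equation of `G` and
from the equation of `Ĝ` multiplied on the right by `L V₁⁻²`, the one for `K` from the equation of
`Ĝ` multiplied by `K`. A kernel vector of the pair matrix produces a vector `e` with `G Ĝ e = e`,
and it vanishes once `e` does (`isNonsingular_pairMatrix`). Everything thus rests on the
invertibility of `I - G Ĝ` (`IsQBD.isUnit_one_sub`).

If `G Ĝ x = x` with `x ≠ 0`, then `Gⁿ x` on the levels `n ≥ 0` and `Ĝⁿ x` on the levels `-n` form a
bounded harmonic function of the doubly infinite chain. It attains its maximum (after a change of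
sign), so by irreducibility it is constant, and `G 1 = 1 = Ĝ 1` (`mulVec_one_of_fixed`). Both
remaining cases contradict this. `G 1 = 1` forces certain return, so the chain is not transient
(`not_isTransient`). `Ĝ 1 = 1` forces a nonnegative mean drift `δ` (`drift_nonneg`); then the level,
corrected by a solution `g` of the Poisson equation, is subharmonic and grows no faster than the
hitting time of level zero, so mean return times cannot be finite (`not_isPositiveRecurrent`). -/

/-- Nonnegative matrices whose sum is row-stochastic. -/
structure IsStochasticTriple {m : ℕ} (C₀ C₁ C₂ : Matrix (Fin m) (Fin m) ℝ) : Prop where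
  nonneg₀ : ∀ i j, 0 ≤ C₀ i j
  nonneg₁ : ∀ i j, 0 ≤ C₁ i j
  nonneg₂ : ∀ i j, 0 ≤ C₂ i j
  row_sum : (C₀ + C₁ + C₂) *ᵥ 1 = 1

theorem IsStochasticTriple.symm {m : ℕ} {C₀ C₁ C₂ : Matrix (Fin m) (Fin m) ℝ}
    (h : IsStochasticTriple C₀ C₁ C₂) : IsStochasticTriple C₂ C₁ C₀ :=
  ⟨h.nonneg₂, h.nonneg₁, h.nonneg₀, by
    rw [show C₂ + C₁ + C₀ = C₀ + C₁ + C₂ by abel]; exact h.row_sum⟩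

theorem mulVec_mono {m : ℕ} {A : Matrix (Fin m) (Fin m) ℝ} (hA : ∀ i j, 0 ≤ A i j)
    {u v : Fin m → ℝ} (h : u ≤ v) : A *ᵥ u ≤ A *ᵥ v := fun i => by
  simp only [mulVec, dotProduct]
  exact Finset.sum_le_sum fun j _ => mul_le_mul_of_nonneg_left (h j) (hA i j)

theorem mul_le_mul_entrywise {m : ℕ} {A B C D : Matrix (Fin m) (Fin m) ℝ}
    (hB : ∀ i j, 0 ≤ B i j) (hC : ∀ i j, 0 ≤ C i j) (hAB : ∀ i j, A i j ≤ B i j)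
    (hCD : ∀ i j, C i j ≤ D i j) (i j : Fin m) : (A * C) i j ≤ (B * D) i j := by
  simp only [mul_apply]
  exact Finset.sum_le_sum fun k _ => mul_le_mul (hAB i k) (hCD k j) (hC k j) (hB i k)

theorem mul_nonneg_entrywise {m : ℕ} {A B : Matrix (Fin m) (Fin m) ℝ}
    (hA : ∀ i j, 0 ≤ A i j) (hB : ∀ i j, 0 ≤ B i j) (i j : Fin m) : 0 ≤ (A * B) i j := by
  simp only [mul_apply]
  exact Finset.sum_nonneg fun k _ => mul_nonneg (hA i k) (hB k j)

/-! ### Minimal nonnegative solutions as limits of a monotone iteration -/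

/-- The natural fixed point iteration for the minimal nonnegative solution. -/
def solIter {m : ℕ} (C₀ C₁ C₂ : Matrix (Fin m) (Fin m) ℝ) : ℕ → Matrix (Fin m) (Fin m) ℝ
  | 0 => 0
  | k + 1 => C₀ + C₁ * solIter C₀ C₁ C₂ k + C₂ * (solIter C₀ C₁ C₂ k * solIter C₀ C₁ C₂ k)

section

variable {m : ℕ} {C₀ C₁ C₂ G : Matrix (Fin m) (Fin m) ℝ}

theorem IsMinNonnegSol.eq_fixedPoint (hG : IsMinNonnegSol C₀ C₁ C₂ G) :
    C₀ + C₁ * G + C₂ * (G * G) = G := by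
  have h := hG.2.1
  rw [sub_mul, one_mul, pow_two] at h
  rw [← sub_eq_zero, ← h]
  abel

theorem solIter_nonneg (h : IsStochasticTriple C₀ C₁ C₂) (k : ℕ) (i j : Fin m) :
    0 ≤ solIter C₀ C₁ C₂ k i j := by
  induction k generalizing i j with
  | zero => simp [solIter]
  | succ k ih =>
    simp only [solIter, Matrix.add_apply]
    have h1 := mul_nonneg_entrywise h.nonneg₁ ih i j
    have h2 := mul_nonneg_entrywise h.nonneg₂ (mul_nonneg_entrywise ih ih) i j
    have h0 := h.nonneg₀ i j
    linarith

theorem solIter_step_mono (h : IsStochasticTriple C₀ C₁ C₂) {X Y : Matrix (Fin m) (Fin m) ℝ}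
    (hX : ∀ i j, 0 ≤ X i j) (hXY : ∀ i j, X i j ≤ Y i j) (i j : Fin m) :
    (C₀ + C₁ * X + C₂ * (X * X)) i j ≤ (C₀ + C₁ * Y + C₂ * (Y * Y)) i j := by
  have hY : ∀ i j, 0 ≤ Y i j := fun i j => (hX i j).trans (hXY i j)
  have h1 := mul_le_mul_entrywise h.nonneg₁ hX (fun _ _ => le_rfl) hXY i j
  have h2 := mul_le_mul_entrywise h.nonneg₂ (mul_nonneg_entrywise hX hX) (fun _ _ => le_rfl)
    (mul_le_mul_entrywise hY hX hXY hXY) i j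
  simp only [Matrix.add_apply]
  linarith

theorem solIter_le_succ (h : IsStochasticTriple C₀ C₁ C₂) (k : ℕ) (i j : Fin m) :
    solIter C₀ C₁ C₂ k i j ≤ solIter C₀ C₁ C₂ (k + 1) i j := by
  induction k generalizing i j with
  | zero => exact solIter_nonneg h 1 i j
  | succ k ih => exact solIter_step_mono h (solIter_nonneg h k) ih i j

theorem solIter_le (h : IsStochasticTriple C₀ C₁ C₂) (hG : IsMinNonnegSol C₀ C₁ C₂ G)
    (k : ℕ) (i j : Fin m) : solIter C₀ C₁ C₂ k i j ≤ G i j := by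
  induction k generalizing i j with
  | zero => exact hG.1 i j
  | succ k ih =>
    have := solIter_step_mono h (solIter_nonneg h k) ih i j
    rwa [hG.eq_fixedPoint] at this

/-- The iterates increase and stay below `G`, so they have a limit; by continuity it is a
nonnegative solution, and minimality of `G` leaves no room between them. Bounds on `G` can therefore
be proved by induction along the iteration. -/
theorem tendsto_solIter (h : IsStochasticTriple C₀ C₁ C₂) (hG : IsMinNonnegSol C₀ C₁ C₂ G) :
    Tendsto (solIter C₀ C₁ C₂) atTop (𝓝 G) := by
  have hconv : ∀ i j, ∃ l, Tendsto (fun k => solIter C₀ C₁ C₂ k i j) atTop (𝓝 l) :=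
    fun i j => ⟨_, tendsto_atTop_ciSup (monotone_nat_of_le_succ fun k => solIter_le_succ h k i j)
      ⟨G i j, by rintro _ ⟨k, rfl⟩; exact solIter_le h hG k i j⟩⟩
  choose F hF using hconv
  have hlim : Tendsto (solIter C₀ C₁ C₂) atTop (𝓝 (of F)) :=
    tendsto_pi_nhds.2 fun i => tendsto_pi_nhds.2 fun j => hF i j
  have hfix : C₀ + C₁ * of F + C₂ * (of F * of F) = of F := by
    have hcont : Continuous fun X : Matrix (Fin m) (Fin m) ℝ => C₀ + C₁ * X + C₂ * (X * X) := by
      fun_prop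
    exact tendsto_nhds_unique ((hcont.tendsto _).comp hlim) (hlim.comp (tendsto_add_atTop_nat 1))
  have hle : ∀ i j, of F i j ≤ G i j := fun i j =>
    le_of_tendsto' (hF i j) fun k => solIter_le h hG k i j
  have hge := hG.2.2 (of F) (fun i j => ge_of_tendsto' (hF i j) fun k => solIter_nonneg h k i j)
    (by
      rw [sub_mul, one_mul, pow_two, add_sub_assoc', sub_add_eq_add_sub, hfix, sub_self])
  rwa [show of F = G from Matrix.ext fun i j => le_antisymm (hle i j) (hge i j)] at hlim

/-- The first passage matrix decreases nonnegative superharmonic functions. -/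
theorem IsMinNonnegSol.mulVec_le (h : IsStochasticTriple C₀ C₁ C₂)
    (hG : IsMinNonnegSol C₀ C₁ C₂ G) {u : ℕ → Fin m → ℝ} (hu0 : ∀ n, 0 ≤ u n)
    (hu : ∀ n, C₀ *ᵥ u n + C₁ *ᵥ u (n + 1) + C₂ *ᵥ u (n + 2) ≤ u (n + 1)) (n : ℕ) :
    G *ᵥ u n ≤ u (n + 1) := by
  -- The induction must cover all `n` at once: the quadratic term uses the bound at `n` and again at
  -- `n + 1`.
  have hk : ∀ k n, solIter C₀ C₁ C₂ k *ᵥ u n ≤ u (n + 1) := by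
    intro k
    induction k with
    | zero => intro n; simpa [solIter] using hu0 (n + 1)
    | succ k ih =>
      intro n
      refine le_trans ?_ (hu n)
      rw [solIter, add_mulVec, add_mulVec, ← mulVec_mulVec, ← mulVec_mulVec, ← mulVec_mulVec]
      exact add_le_add (add_le_add le_rfl (mulVec_mono h.nonneg₁ (ih n)))
        (mulVec_mono h.nonneg₂
          ((mulVec_mono (solIter_nonneg h k) (ih n)).trans (ih (n + 1))))
  have hc : Continuous fun X : Matrix (Fin m) (Fin m) ℝ => X *ᵥ u n := by fun_prop
  exact le_of_tendsto' ((hc.tendsto G).comp (tendsto_solIter h hG)) fun k => hk k n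

theorem IsMinNonnegSol.mulVec_one_le (h : IsStochasticTriple C₀ C₁ C₂)
    (hG : IsMinNonnegSol C₀ C₁ C₂ G) : G *ᵥ 1 ≤ 1 :=
  hG.mulVec_le h (u := fun _ => 1) (fun _ _ => zero_le_one)
    (fun _ => by rw [← add_mulVec, ← add_mulVec, h.row_sum]) 0

theorem IsMinNonnegSol.pow_mulVec_le (h : IsStochasticTriple C₀ C₁ C₂)
    (hG : IsMinNonnegSol C₀ C₁ C₂ G) {u : Fin m → ℝ} {c : ℝ} (hu : ∀ i, |u i| ≤ c)
    (n : ℕ) (i : Fin m) : |((G ^ n) *ᵥ u) i| ≤ c := by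
  have hc : 0 ≤ c := (abs_nonneg _).trans (hu i)
  induction n generalizing i with
  | zero => simpa using hu i
  | succ n ih =>
    rw [pow_succ', ← mulVec_mulVec]
    calc |(G *ᵥ (G ^ n *ᵥ u)) i| ≤ ∑ j, |G i j * (G ^ n *ᵥ u) j| := by
          simp only [mulVec, dotProduct]
          exact Finset.abs_sum_le_sum_abs _ _
      _ ≤ ∑ j, G i j * c := Finset.sum_le_sum fun j _ => by
          rw [abs_mul, abs_of_nonneg (hG.1 i j)]
          exact mul_le_mul_of_nonneg_left (ih j) (hG.1 i j)
      _ = (G *ᵥ 1) i * c := by simp [mulVec, dotProduct, Finset.sum_mul]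
      _ ≤ 1 * c := mul_le_mul_of_nonneg_right (hG.mulVec_one_le h i) hc
      _ = c := one_mul c

/-- The sequence `u, G u, G² u` is harmonic at its middle term; this is what lets powers of `G`
extend a vector harmonically from level to level. -/
theorem IsMinNonnegSol.harmonic (hG : IsMinNonnegSol C₀ C₁ C₂ G) (u : Fin m → ℝ) :
    C₀ *ᵥ u + C₁ *ᵥ (G *ᵥ u) + C₂ *ᵥ (G *ᵥ (G *ᵥ u)) = G *ᵥ u := by
  conv_rhs => rw [← hG.eq_fixedPoint]
  simp only [add_mulVec, mulVec_mulVec]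

/-- At a point where a function bounded by `c` has weighted average `c`, all terms of positive
weight attain `c`. -/
theorem IsStochasticTriple.eq_of_average (h : IsStochasticTriple C₀ C₁ C₂)
    {u v w : Fin m → ℝ} {c : ℝ} (hu : ∀ i, u i ≤ c) (hv : ∀ i, v i ≤ c) (hw : ∀ i, w i ≤ c)
    {i : Fin m} (hi : c ≤ (C₀ *ᵥ u + C₁ *ᵥ v + C₂ *ᵥ w) i) (j : Fin m) :
    (0 < C₀ i j → u j = c) ∧ (0 < C₁ i j → v j = c) ∧ (0 < C₂ i j → w j = c) := by
  have hsum : ∑ j, (C₀ i j * (c - u j) + C₁ i j * (c - v j) + C₂ i j * (c - w j)) ≤ 0 := by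
    have h1 := congrFun h.row_sum i
    simp only [Pi.add_apply, mulVec, dotProduct, Matrix.add_apply, Pi.one_apply, mul_one,
      Finset.sum_add_distrib] at h1 hi
    simp only [mul_sub, Finset.sum_add_distrib, Finset.sum_sub_distrib, ← Finset.sum_mul]
    have : ((∑ j, C₀ i j) + (∑ j, C₁ i j) + ∑ j, C₂ i j) * c = c := by rw [h1, one_mul]
    linarith
  have n0 : ∀ j, 0 ≤ C₀ i j * (c - u j) := fun j =>
    mul_nonneg (h.nonneg₀ i j) (sub_nonneg.2 (hu j))
  have n1 : ∀ j, 0 ≤ C₁ i j * (c - v j) := fun j =>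
    mul_nonneg (h.nonneg₁ i j) (sub_nonneg.2 (hv j))
  have n2 : ∀ j, 0 ≤ C₂ i j * (c - w j) := fun j =>
    mul_nonneg (h.nonneg₂ i j) (sub_nonneg.2 (hw j))
  have hz := (Finset.sum_eq_zero_iff_of_nonneg fun j _ =>
    add_nonneg (add_nonneg (n0 j) (n1 j)) (n2 j)).1
      (le_antisymm hsum (Finset.sum_nonneg fun j _ =>
        add_nonneg (add_nonneg (n0 j) (n1 j)) (n2 j))) j (Finset.mem_univ j)
  have e0 := n0 j
  have e1 := n1 j
  have e2 := n2 j
  have key : ∀ {a b : ℝ}, a * (c - b) = 0 → 0 < a → b = c := fun hab ha => by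
    rcases mul_eq_zero.1 hab with h' | h'
    · exact absurd h' ha.ne'
    · linarith
  exact ⟨key (by linarith), key (by linarith), key (by linarith)⟩

end

/-! ### Harmonic functions of the doubly infinite chain -/

section

variable {m : ℕ} {Am A0 A1 G Ghat : Matrix (Fin m) (Fin m) ℝ}

/-- Maximum principle for the doubly infinite QBD. -/
theorem eq_of_harmonic_of_reaches (h : IsStochasticTriple Am A0 A1) {f : ℤ → Fin m → ℝ} {c : ℝ}
    (hf : ∀ n, Am *ᵥ f (n - 1) + A0 *ᵥ f n + A1 *ᵥ f (n + 1) = f n) (hc : ∀ n i, f n i ≤ c)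
    {x y : ℤ × Fin m} (hx : f x.1 x.2 = c) (hxy : Reaches (doublyInfinite Am A0 A1) x y) :
    f y.1 y.2 = c := by
  induction hxy with
  | refl => exact hx
  | @tail a b _ hab ih =>
    have key := h.eq_of_average (hc (a.1 - 1)) (hc a.1) (hc (a.1 + 1))
      (i := a.2) (by rw [hf, ih]) b.2
    simp only [doublyInfinite, of_apply] at hab
    split_ifs at hab with h1 h2 h3
    · rw [h1]; exact key.2.2 hab
    · rw [h2]; exact key.2.1 hab
    · rw [show b.1 = a.1 - 1 by omega]; exact key.1 hab
    · exact absurd hab (lt_irrefl _)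

theorem reaches_of_isIrreducible {S : Type*} {A : Matrix S S ℝ} (hA : A.IsIrreducible) (x y : S) :
    Reaches A x y := by
  let := toQuiver A
  obtain ⟨p, -⟩ := hA.connected x y
  induction p with
  | nil => exact Relation.ReflTransGen.refl
  | cons _ e ih => exact ih.tail e.down

/-- Irreducibility of the phase process makes the doubly infinite QBD irreducible. -/
theorem HasOneFinalClass.reaches
    (hA : (Am + A0 + A1).IsIrreducible) (hF : HasOneFinalClass Am A0 A1) (x y : ℤ × Fin m) :
    Reaches (doublyInfinite Am A0 A1) x y := by
  obtain ⟨E, ⟨e, he⟩, hC, -⟩ := hF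
  obtain ⟨-, hcomm, hclosed⟩ := (hC {x | x.2 ∈ E}).2 rfl
  have hE : ∀ j, j ∈ E := by
    intro j
    induction reaches_of_isIrreducible hA e j with
    | refl => exact he
    | @tail a b _ hab ih =>
      simp only [Matrix.add_apply] at hab
      by_contra hb
      -- If `b` were outside `E`, closedness would kill the `(a, b)` entries of all three blocks,
      -- while their sum is positive.
      have step : ∀ n : ℤ, doublyInfinite Am A0 A1 (0, a) (n, b) ≤ 0 := fun n =>
        not_lt.1 fun hlt => hb (hclosed (0, a) ih (n, b) hlt)
      have s0 := step 0
      have s1 := step 1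
      have s2 := step (-1)
      simp [doublyInfinite] at s0 s1 s2
      linarith
  exact hcomm x (hE x.2) y (hE y.2)

/-- If `G Ĝ` has the eigenvalue one, the doubly infinite QBD is recurrent: passage one level down
and one level up are both certain. -/
theorem mulVec_one_of_fixed (h : IsStochasticTriple Am A0 A1)
    (hD : ∀ x y, Reaches (doublyInfinite Am A0 A1) x y)
    (hG : IsMinNonnegSol Am A0 A1 G) (hGhat : IsMinNonnegSol A1 A0 Am Ghat)
    {x : Fin m → ℝ} (hx0 : x ≠ 0) (hx : G *ᵥ (Ghat *ᵥ x) = x) :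
    G *ᵥ 1 = 1 ∧ Ghat *ᵥ 1 = 1 := by
  obtain ⟨i₁, hi₁⟩ := Function.ne_iff.1 hx0
  obtain ⟨i₀, -, hmax⟩ := Finset.exists_max_image Finset.univ (fun i => |x i|) ⟨i₁, Finset.mem_univ _⟩
  have hpos : 0 < |x i₀| := (abs_pos.2 hi₁).trans_le (hmax i₁ (Finset.mem_univ _))
  -- Replacing `x` by `-x` turns the maximum of `|x|` into a maximum of `x`.
  wlog hsgn : 0 ≤ x i₀ generalizing x
  · exact this (x := -x) (neg_ne_zero.2 hx0) (by simp [mulVec_neg, hx]) (by simpa using hi₁)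
      (by simpa using hmax) (by simpa using hpos) (by simp at hsgn ⊢; linarith)
  rw [abs_of_nonneg hsgn] at hpos
  have hle : ∀ i, |x i| ≤ x i₀ := fun i => by
    simpa [abs_of_nonneg hsgn] using hmax i (Finset.mem_univ _)
  set f : ℤ → Fin m → ℝ := fun n =>
    if 0 ≤ n then (G ^ n.toNat) *ᵥ x else (Ghat ^ (-n).toNat) *ᵥ x with hfdef
  have fnat : ∀ n : ℕ, f n = (G ^ n) *ᵥ x := fun n => by simp [hfdef]
  have fneg : ∀ n : ℕ, f (-n) = (Ghat ^ n) *ᵥ x := fun n => by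
    rcases n with _ | n
    · simp [hfdef]
    · have : ¬ (0 : ℤ) ≤ -((n + 1 : ℕ) : ℤ) := by omega
      simp only [hfdef, if_neg this]
      simp
  -- The hypothesis `G Ĝ x = x` is the case `n = 0`. It makes `f 0 = G f (-1)`, so the two halves
  -- fit together and harmonicity holds at level `0` as well.
  have hup : ∀ n : ℤ, 0 ≤ n → f n = G *ᵥ f (n - 1) := by
    intro n hn
    obtain ⟨k, rfl⟩ := Int.eq_ofNat_of_zero_le hn
    rcases k with _ | k
    · have h1 := fneg 1
      have h0 := fnat 0
      simp only [Nat.cast_one, pow_one, pow_zero, one_mulVec, Nat.cast_zero] at h1 h0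
      simp [h0, h1, hx]
    · rw [show ((k + 1 : ℕ) : ℤ) - 1 = (k : ℕ) by push_cast; ring, fnat, fnat, mulVec_mulVec,
        pow_succ']
  have hdn : ∀ n : ℤ, n < 0 → f n = Ghat *ᵥ f (n + 1) := by
    intro n hn
    obtain ⟨k, rfl⟩ : ∃ k : ℕ, n = -((k + 1 : ℕ) : ℤ) := ⟨(-n - 1).toNat, by omega⟩
    rw [show -((k + 1 : ℕ) : ℤ) + 1 = -(k : ℕ) by push_cast; ring, fneg, fneg, mulVec_mulVec,
      pow_succ']
  have hharm : ∀ n, Am *ᵥ f (n - 1) + A0 *ᵥ f n + A1 *ᵥ f (n + 1) = f n := by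
    intro n
    rcases le_or_gt 0 n with hn | hn
    · have e1 := hup (n + 1) (by omega)
      rw [add_sub_cancel_right, hup n hn] at e1
      rw [e1, hup n hn]
      exact hG.harmonic _
    · have e1 := hdn (n - 1) (by omega)
      rw [sub_add_cancel, hdn n hn] at e1
      rw [e1, hdn n hn]
      refine Eq.trans ?_ (hGhat.harmonic (f (n + 1)))
      abel
  have hbd : ∀ n i, f n i ≤ x i₀ := by
    intro n i
    refine (le_abs_self _).trans ?_
    simp only [hfdef]
    split_ifs
    · exact hG.pow_mulVec_le h hle _ i
    · exact hGhat.pow_mulVec_le h.symm hle _ i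
  have hconst : ∀ n i, f n i = x i₀ := fun n i =>
    eq_of_harmonic_of_reaches h hharm hbd (x := (0, i₀)) (y := (n, i)) (by simp [hfdef])
      (hD _ _)
  have hvec : ∀ n, f n = x i₀ • (1 : Fin m → ℝ) := fun n => funext fun i => by
    simp [hconst n i]
  constructor
  · have := hup 0 le_rfl
    rw [hvec, hvec, mulVec_smul] at this
    exact (smul_right_injective _ hpos.ne' this).symm
  · have := hdn (-1) (by norm_num)
    rw [hvec, hvec, mulVec_smul] at this
    exact (smul_right_injective _ hpos.ne' this).symm

end

end QBD

namespace QBD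
open Filter Topology Matrix

/-! ### Hitting probabilities and mean hitting times of a general chain -/

section

variable {S : Type*} {P : Matrix S S ℝ} {y : S}

theorem tsum_ne_add (g : S → ℝ≥0∞) (y : S) :
    ∑' z : {z : S // z ≠ y}, g z + g y = ∑' z, g z := by
  classical
  rw [ENNReal.tsum_eq_add_tsum_ite y, add_comm]
  congr 1
  rw [show (∑' z : {z : S // z ≠ y}, g z) = ∑' z : ({z | z ≠ y} : Set S), g z from rfl,
    tsum_subtype]
  refine tsum_congr fun z => ?_
  by_cases h : z = y <;> simp [h]

theorem IsRowStochastic.tsum_ofReal (hP : IsRowStochastic P) (x : S) :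
    ∑' z, ENNReal.ofReal (P x z) = 1 := by
  rw [← ENNReal.ofReal_tsum_of_nonneg (hP.1 x) (hP.2 x).summable, (hP.2 x).tsum_eq,
    ENNReal.ofReal_one]

/-- Minimum principle for superharmonic functions. -/
theorem IsRowStochastic.eq_of_superharmonic (hP : IsRowStochastic P) {f : S → ℝ≥0∞} {c : ℝ≥0∞}
    (hctop : c ≠ ∞) (hf : ∀ x, ∑' z, ENNReal.ofReal (P x z) * f z ≤ f x) (hc : ∀ x, c ≤ f x)
    {x z : S} (hx : f x = c) (hxz : Reaches P x z) : f z = c := by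
  induction hxz with
  | refl => exact hx
  | @tail a b _ hab ih =>
    by_contra hne
    have hlt : c < f b := lt_of_le_of_ne (hc b) (Ne.symm hne)
    have hsum : ∑' z, ENNReal.ofReal (P a z) * c = c := by
      rw [ENNReal.tsum_mul_right, hP.tsum_ofReal, one_mul]
    have := ENNReal.tsum_lt_tsum (f := fun z => ENNReal.ofReal (P a z) * c)
      (g := fun z => ENNReal.ofReal (P a z) * f z) (i := b) (by rw [hsum]; exact hctop)
      (fun z => mul_le_mul_right (hc z) _)
      (ENNReal.mul_lt_mul_right (ENNReal.ofReal_pos.2 hab).ne' ENNReal.ofReal_ne_top hlt)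
    rw [hsum] at this
    exact absurd (this.trans_le (hf a)) (by rw [ih]; exact lt_irrefl c)

/-- The transition operator of the chain killed when it enters `y`. -/
noncomputable def killed (P : Matrix S S ℝ) (y : S) (f : S → ℝ≥0∞) (x : S) : ℝ≥0∞ :=
  ∑' z : {z : S // z ≠ y}, ENNReal.ofReal (P x z) * f z

theorem killed_mono {f g : S → ℝ≥0∞} (h : f ≤ g) : killed P y f ≤ killed P y g := fun _ =>
  ENNReal.tsum_le_tsum fun _ => mul_le_mul_right (h _) _

theorem killed_tsum (f : ℕ → S → ℝ≥0∞) (x : S) :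
    killed P y (fun z => ∑' n, f n z) x = ∑' n, killed P y (f n) x := by
  simp only [killed, ← ENNReal.tsum_mul_left]
  exact ENNReal.tsum_comm

theorem killed_add_mul (f : S → ℝ≥0∞) (x : S) :
    killed P y f x + ENNReal.ofReal (P x y) * f y = ∑' z, ENNReal.ofReal (P x z) * f z :=
  tsum_ne_add (fun z => ENNReal.ofReal (P x z) * f z) y

/-- The probability that the chain started in `x` ever visits `y` after time `0`. -/
noncomputable def hitProb (P : Matrix S S ℝ) (y x : S) : ℝ≥0∞ := ∑' n, firstPassage P y n x

/-- The probability that the chain started in `x` does not visit `y` at the times `1, …, k`. -/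
noncomputable def survival (P : Matrix S S ℝ) (y : S) : ℕ → S → ℝ≥0∞
  | 0 => fun _ => 1
  | k + 1 => killed P y (survival P y k)

theorem firstPassage_add_two (n : ℕ) :
    firstPassage P y (n + 2) = killed P y (firstPassage P y (n + 1)) := rfl

theorem hitProb_eq_tsum_succ (x : S) :
    hitProb P y x = ∑' n, firstPassage P y (n + 1) x := by
  rw [hitProb, tsum_eq_zero_add' ENNReal.summable, firstPassage, zero_add]

theorem hitProb_eq (x : S) :
    hitProb P y x = killed P y (hitProb P y) x + ENNReal.ofReal (P x y) := by
  rw [hitProb_eq_tsum_succ, tsum_eq_zero_add' ENNReal.summable, add_comm]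
  congr 1
  simp only [firstPassage_add_two, ← killed_tsum, ← hitProb_eq_tsum_succ]

/-- Either `y` is avoided during the first `k` steps or there is a unique time of first passage
among them; the induction conditions on the first step. -/
theorem IsRowStochastic.survival_add_sum (hP : IsRowStochastic P) (k : ℕ) (x : S) :
    survival P y k x + ∑ n ∈ Finset.range k, firstPassage P y (n + 1) x = 1 := by
  induction k generalizing x with
  | zero => simp [survival]
  | succ k ih =>
    have h1 : killed P y (fun _ => 1) x + ENNReal.ofReal (P x y) = 1 := by
      have := killed_add_mul (P := P) (y := y) (fun _ => 1) x
      simpa only [mul_one, hP.tsum_ofReal] using this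
    rw [Finset.sum_range_succ', ← add_assoc]
    refine Eq.trans ?_ h1
    congr 1
    simp only [firstPassage_add_two, survival]
    rw [show (fun _ : S => (1 : ℝ≥0∞)) = fun z => survival P y k z +
      ∑ n ∈ Finset.range k, firstPassage P y (n + 1) z from funext fun z => (ih z).symm]
    simp only [killed, mul_add, ENNReal.tsum_add, Finset.mul_sum]
    rw [Summable.tsum_finsetSum fun _ _ => ENNReal.summable]

theorem IsRowStochastic.hitProb_le_one (hP : IsRowStochastic P) (x : S) :
    hitProb P y x ≤ 1 := by
  rw [hitProb_eq_tsum_succ]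
  exact ENNReal.tsum_le_of_sum_range_le fun k => by
    rw [← hP.survival_add_sum (y := y) k x]
    exact le_add_self

/-- The expected time of the first visit to `y` after time `0`. -/
noncomputable def meanHittingTime (P : Matrix S S ℝ) (y x : S) : ℝ≥0∞ := ∑' k, survival P y k x

theorem meanHittingTime_eq (x : S) :
    meanHittingTime P y x = 1 + killed P y (meanHittingTime P y) x := by
  rw [meanHittingTime, tsum_eq_zero_add' ENNReal.summable]
  congr 1
  simp only [survival, ← killed_tsum]
  rfl

/-- Tail-sum formula for an expectation: since return is certain, the survival probability at time
`k` is the tail of the first-passage law beyond `k`, and exchanging the sums counts each `N` once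
for every `k < N`. -/
theorem IsRowStochastic.meanHittingTime_self_le (hP : IsRowStochastic P)
    (hy : returnProb P y = 1) : meanHittingTime P y y ≤ meanReturnTime P y := by
  set a : ℕ → ℝ≥0∞ := fun n => firstPassage P y n y with ha
  have hsurv : ∀ k, survival P y k y = ∑' n, a (n + k + 1) := by
    intro k
    have h1 : ∑ n ∈ Finset.range k, a (n + 1) + ∑' n, a (n + k + 1) = 1 := by
      rw [← hy, show returnProb P y = hitProb P y y from rfl, hitProb_eq_tsum_succ,
        ENNReal.summable.sum_add_tsum_nat_add' (f := fun n => a (n + 1))]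
    have h2 := hP.survival_add_sum (y := y) k y
    rw [add_comm, ← h1] at h2
    refine (ENNReal.add_right_inj ?_).1 h2
    -- Cancellation in `ℝ≥0∞` needs a finite partial sum; it is part of a total equal to one.
    intro htop
    rw [htop, top_add] at h1
    exact ENNReal.top_ne_one h1
  calc meanHittingTime P y y = ∑' k, ∑' n, a (n + k + 1) := tsum_congr hsurv
    _ ≤ ∑' k, ∑' N, if k < N then a N else 0 := ENNReal.tsum_le_tsum fun k => by
        refine le_trans (le_of_eq ?_) (ENNReal.tsum_comp_le_tsum_of_injective
          (f := fun n => n + k + 1) (fun p q h => by simpa using h)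
          (fun N => if k < N then a N else 0))
        refine tsum_congr fun n => ?_
        rw [if_pos (by omega)]
    _ = ∑' N, ∑' k, if k < N then a N else 0 := ENNReal.tsum_comm
    _ = meanReturnTime P y := tsum_congr fun N => by
        rw [tsum_eq_sum (s := Finset.range N) (fun k hk => if_neg (by simpa using hk)),
          Finset.sum_congr rfl fun k hk => if_pos (Finset.mem_range.1 hk)]
        simp [ha]

/-- Finiteness travels along transitions: in the one-step equation at `a`, the value at a successor
`b ≠ y` occurs with positive weight. -/
theorem IsRowStochastic.meanHittingTime_lt_top (hP : IsRowStochastic P)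
    (hy : returnProb P y = 1) (hm : meanReturnTime P y < ∞) {x : S} (hx : Reaches P y x) :
    meanHittingTime P y x < ∞ := by
  have hself := (hP.meanHittingTime_self_le hy).trans_lt hm
  induction hx with
  | refl => exact hself
  | @tail a b _ hab ih =>
    by_cases hb : b = y
    · rwa [hb]
    · have hle : ENNReal.ofReal (P a b) * meanHittingTime P y b ≤ meanHittingTime P y a := by
        rw [meanHittingTime_eq a]
        exact le_add_left (ENNReal.le_tsum
          (f := fun z : {z : S // z ≠ y} => ENNReal.ofReal (P a z) * meanHittingTime P y z) ⟨b, hb⟩)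
      exact ENNReal.lt_top_of_mul_ne_top_right (hle.trans_lt ih).ne (ENNReal.ofReal_pos.2 hab).ne'

/-- A subharmonic function of the killed chain dominated by a finite mean hitting time vanishes. -/
theorem eq_zero_of_le_meanHittingTime {f : S → ℝ≥0∞} (hf : f ≤ killed P y f)
    (hle : f ≤ meanHittingTime P y) {x : S} (hx : meanHittingTime P y x < ∞) : f x = 0 := by
  -- Each application of the killed operator removes the first term of the series of survival
  -- probabilities, so `f` lies below every tail of a series that converges at `x`.
  have hk : ∀ k, f ≤ fun x => ∑' n, survival P y (n + k) x := by
    intro k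
    induction k with
    | zero => exact hle
    | succ k ih =>
      refine hf.trans ((killed_mono ih).trans fun x => ?_)
      rw [killed_tsum]
      rfl
  have hlim := ENNReal.tendsto_sum_nat_add (fun n => survival P y n x) hx.ne
  exact le_antisymm (ge_of_tendsto' hlim fun k => hk k x) zero_le

end

/-! ### Transience, mean drift and positive recurrence of the QBD -/

section

variable {m : ℕ} {B Am A0 A1 G Ghat : Matrix (Fin m) (Fin m) ℝ}

theorem tsum_transition_succ (f : ℕ × Fin m → ℝ≥0∞) (n : ℕ) (i : Fin m) :
    ∑' z, ENNReal.ofReal (transition B Am A0 A1 (n + 1, i) z) * f z =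
      ∑ j, (ENNReal.ofReal (Am i j) * f (n, j) + ENNReal.ofReal (A0 i j) * f (n + 1, j) +
        ENNReal.ofReal (A1 i j) * f (n + 2, j)) := by
  rw [ENNReal.tsum_prod', tsum_eq_sum (s := {n, n + 1, n + 2})]
  · rw [Finset.sum_insert (by simp), Finset.sum_insert (by simp), Finset.sum_singleton]
    simp only [tsum_fintype, Finset.sum_add_distrib, add_assoc]
    congr 1
    · refine Finset.sum_congr rfl fun j _ => ?_
      simp [transition, show n ≠ n + 1 + 1 by omega]
    · congr 1 <;> refine Finset.sum_congr rfl fun j _ => ?_ <;> simp [transition]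
  · intro k hk
    simp only [Finset.mem_insert, Finset.mem_singleton, not_or] at hk
    refine ENNReal.tsum_eq_zero.2 fun j => ?_
    simp [transition, show k ≠ n + 1 + 1 by omega, hk.1, hk.2.1]

theorem isStochasticTriple_of_isRowStochastic
    (hP : IsRowStochastic (transition B Am A0 A1)) : IsStochasticTriple Am A0 A1 := by
  have h0 : ∀ i j, 0 ≤ Am i j := fun i j => by
    simpa [transition] using hP.1 (1, i) (0, j)
  have h1 : ∀ i j, 0 ≤ A0 i j := fun i j => by
    simpa [transition] using hP.1 (1, i) (1, j)
  have h2 : ∀ i j, 0 ≤ A1 i j := fun i j => by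
    simpa [transition] using hP.1 (1, i) (2, j)
  refine ⟨h0, h1, h2, funext fun i => ?_⟩
  have h := tsum_transition_succ (B := B) (Am := Am) (A0 := A0) (A1 := A1) (fun _ => 1) 0 i
  simp only [mul_one] at h
  rw [hP.tsum_ofReal, Finset.sum_congr rfl fun j _ => by
    rw [← ENNReal.ofReal_add (h0 i j) (h1 i j),
      ← ENNReal.ofReal_add (add_nonneg (h0 i j) (h1 i j)) (h2 i j)],
    ← ENNReal.ofReal_sum_of_nonneg fun j _ => add_nonneg (add_nonneg (h0 i j) (h1 i j)) (h2 i j)]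
    at h
  simpa [mulVec, dotProduct] using (ENNReal.ofReal_eq_one.1 h.symm)

/-- If passage to the next lower level is certain, every state is visited again with
certainty. -/
theorem not_isTransient (hm : 0 < m) (hP : IsRowStochastic (transition B Am A0 A1))
    (hirr : (transition B Am A0 A1).IsIrreducible) (hG : IsMinNonnegSol Am A0 A1 G)
    (hG1 : G *ᵥ 1 = 1) : ¬ IsTransient (transition B Am A0 A1) := by
  classical
  intro htr
  have hT := isStochasticTriple_of_isRowStochastic hP
  set P := transition B Am A0 A1 with hPdef
  set y : ℕ × Fin m := (0, ⟨0, hm⟩)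
  -- Setting the value at `y` to `1` makes the hitting probability superharmonic for the unkilled
  -- chain; at `y` the average is the return probability.
  set f : ℕ × Fin m → ℝ≥0∞ := fun x => if x = y then 1 else hitProb P y x with hfdef
  have hfsum : ∀ x, ∑' z, ENNReal.ofReal (P x z) * f z = hitProb P y x := by
    intro x
    rw [← killed_add_mul (y := y), hitProb_eq]
    congr 1
    · refine tsum_congr fun z => ?_
      simp [hfdef, z.2]
    · simp [hfdef]
  have hf1 : ∀ x, f x ≤ 1 := fun x => by
    simp only [hfdef]
    split_ifs
    · exact le_rfl
    · exact hP.hitProb_le_one x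
  have hsup : ∀ x, ∑' z, ENNReal.ofReal (P x z) * f z ≤ f x := fun x => by
    rw [hfsum]
    simp only [hfdef]
    split_ifs
    · exact hP.hitProb_le_one x
    · exact le_rfl
  have hfin : ∀ x, f x ≠ ∞ := fun x => ((hf1 x).trans_lt ENNReal.one_lt_top).ne
  set u : ℕ → Fin m → ℝ := fun n i => (f (n, i)).toReal with hudef
  have hfu : ∀ n i, f (n, i) = ENNReal.ofReal (u n i) := fun n i =>
    (ENNReal.ofReal_toReal (hfin _)).symm
  have hu0 : ∀ n i, 0 ≤ u n i := fun n i => ENNReal.toReal_nonneg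
  have hGu := fun n => hG.mulVec_le hT (u := u) (fun n i => hu0 n i) (fun n i => by
    have h := hsup (n + 1, i)
    rw [hPdef, tsum_transition_succ] at h
    have h0 := fun j => mul_nonneg (hT.nonneg₀ i j) (hu0 n j)
    have h1 := fun j => mul_nonneg (hT.nonneg₁ i j) (hu0 (n + 1) j)
    have h2 := fun j => mul_nonneg (hT.nonneg₂ i j) (hu0 (n + 2) j)
    rw [Finset.sum_congr rfl fun j _ => by
      rw [hfu, hfu, hfu, ← ENNReal.ofReal_mul (hT.nonneg₀ i j),
        ← ENNReal.ofReal_mul (hT.nonneg₁ i j), ← ENNReal.ofReal_mul (hT.nonneg₂ i j),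
        ← ENNReal.ofReal_add (h0 j) (h1 j), ← ENNReal.ofReal_add (add_nonneg (h0 j) (h1 j)) (h2 j)],
      ← ENNReal.ofReal_sum_of_nonneg fun j _ => add_nonneg (add_nonneg (h0 j) (h1 j)) (h2 j),
      hfu, ENNReal.ofReal_le_ofReal_iff (hu0 _ _)] at h
    simpa [mulVec, dotProduct, Finset.sum_add_distrib] using h) n
  obtain ⟨i₀, -, hmin⟩ := Finset.exists_min_image Finset.univ (u 0) ⟨⟨0, hm⟩, Finset.mem_univ _⟩
  -- Because `G 1 = 1`, a lower bound on one level passes to the next, so the global minimum is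
  -- attained on level zero and the minimum principle applies.
  have hlow : ∀ n i, u 0 i₀ ≤ u n i := by
    intro n
    induction n with
    | zero => exact fun i => hmin i (Finset.mem_univ i)
    | succ n ih =>
      intro i
      have h1 : u 0 i₀ • (1 : Fin m → ℝ) ≤ u n := fun j => by simpa using ih j
      have h2 := (mulVec_mono hG.1 h1).trans (hGu n) i
      simpa [mulVec_smul, hG1] using h2
  have hconst : ∀ x, f x = f (0, i₀) := fun x =>
    hP.eq_of_superharmonic (hfin _) hsup (fun z => by
      rw [show z = (z.1, z.2) from rfl, hfu, hfu]
      exact ENNReal.ofReal_le_ofReal (hlow _ _)) rfl (reaches_of_isIrreducible hirr _ _)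
  have hone : ∀ x, f x = 1 := fun x => by
    rw [hconst x, ← hconst y]
    simp [hfdef]
  have hret := hfsum y
  simp only [hone, mul_one] at hret
  rw [hP.tsum_ofReal] at hret
  exact (htr y).ne hret.symm

/-- Solvability of the Poisson equation of an irreducible doubly infinite QBD. -/
theorem exists_poisson_solution (hm : 0 < m) (h : IsStochasticTriple Am A0 A1)
    (hD : ∀ x y, Reaches (doublyInfinite Am A0 A1) x y) (d : Fin m → ℝ) :
    ∃ (g : Fin m → ℝ) (δ : ℝ), Am *ᵥ g + A0 *ᵥ g + A1 *ᵥ g + d = g + δ • 1 := by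
  set i₁ : Fin m := ⟨0, hm⟩
  let Φ : (Fin m → ℝ) →ₗ[ℝ] (Fin m → ℝ) :=
    -- `I - (A₋₁ + A₀ + A₁)` kills constants; adding the rank-one term `g ↦ g i₁ • 1` makes it
    -- injective, hence surjective, and `δ` is the coordinate `g i₁` of the preimage.
    LinearMap.id - (Am + A0 + A1).mulVecLin + (LinearMap.proj i₁).smulRight (1 : Fin m → ℝ)
  have hΦ : ∀ g, Φ g = g - (Am *ᵥ g + A0 *ᵥ g + A1 *ᵥ g) + g i₁ • 1 := fun g => by
    simp [Φ]
  -- At a minimum of `g` the value is at most its average, so the rank-one term must be nonnegative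
  -- there. Applied to `g` and `-g`, this gives `g i₁ = 0`.
  have hmax : ∀ g : Fin m → ℝ, Φ g = 0 → 0 ≤ g i₁ := by
    intro g hg
    obtain ⟨i, -, hi⟩ := Finset.exists_min_image Finset.univ g ⟨i₁, Finset.mem_univ _⟩
    have h1 : g i • (1 : Fin m → ℝ) ≤ g := fun j => by simpa using hi j (Finset.mem_univ j)
    have h2 := add_le_add (add_le_add (mulVec_mono h.nonneg₀ h1) (mulVec_mono h.nonneg₁ h1))
      (mulVec_mono h.nonneg₂ h1) i
    rw [← add_mulVec, ← add_mulVec, mulVec_smul, h.row_sum] at h2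
    have h3 := congrFun hg i
    rw [hΦ] at h3
    simp at h2 h3
    linarith
  have hinj : Function.Injective Φ := by
    rw [injective_iff_map_eq_zero]
    intro g hg
    have h0 : g i₁ = 0 := le_antisymm
      (by simpa using hmax (-g) (by rw [map_neg, hg, neg_zero])) (hmax g hg)
    have hharm : Am *ᵥ g + A0 *ᵥ g + A1 *ᵥ g = g := by
      rw [hΦ, h0, zero_smul, add_zero, sub_eq_zero] at hg
      exact hg.symm
    obtain ⟨i, -, hi⟩ := Finset.exists_max_image Finset.univ g ⟨i₁, Finset.mem_univ _⟩
    have hconst : ∀ j, g j = g i := fun j =>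
      eq_of_harmonic_of_reaches h (f := fun _ => g) (fun _ => hharm)
        (fun _ j => hi j (Finset.mem_univ j)) (x := (0, i)) (y := (0, j)) rfl (hD _ _)
    exact funext fun j => by rw [hconst j, ← hconst i₁, h0, Pi.zero_apply]
  obtain ⟨g, hg⟩ := LinearMap.injective_iff_surjective.1 hinj d
  exact ⟨g, g i₁, by rw [← hg, hΦ]; abel⟩

/-- If passage to the next higher level is certain, the mean drift is nonnegative. -/
theorem drift_nonneg (hm : 0 < m) (h : IsStochasticTriple Am A0 A1)
    (hGhat : IsMinNonnegSol A1 A0 Am Ghat) (hG1 : Ghat *ᵥ 1 = 1) {g : Fin m → ℝ} {δ : ℝ}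
    (hg : Am *ᵥ g + A0 *ᵥ g + A1 *ᵥ g + (A1 *ᵥ 1 - Am *ᵥ 1) = g + δ • 1) : 0 ≤ δ := by
  by_contra! hδ
  -- The test function is `(1 - ε)ⁿ (1 + ε g)` on level `-n`. Its superharmonicity defect is `ε`
  -- times the displayed expression, with leading term `δ`; so `δ < 0` makes it superharmonic and
  -- positive for small `ε`.
  have hev : ∀ᶠ ε : ℝ in 𝓝[>] 0, (∀ i, δ + ε * (g i + (Am *ᵥ 1) i - (A0 *ᵥ g) i
      - 2 * (Am *ᵥ g) i + ε * (Am *ᵥ g) i) < 0) ∧ (∀ i, 0 < 1 + ε * g i) ∧ ε < 1 := by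
    refine Filter.Eventually.filter_mono nhdsWithin_le_nhds ?_
    refine (eventually_all.2 fun i => ?_).and ((eventually_all.2 fun i => ?_).and
      (eventually_lt_nhds zero_lt_one))
    · have hc : Continuous fun ε : ℝ => δ + ε * (g i + (Am *ᵥ 1) i - (A0 *ᵥ g) i
          - 2 * (Am *ᵥ g) i + ε * (Am *ᵥ g) i) := by fun_prop
      exact (hc.tendsto 0).eventually_lt_const (by simpa using hδ)
    · have hc : Continuous fun ε : ℝ => 1 + ε * g i := by fun_prop
      exact (hc.tendsto 0).eventually_const_lt (by simp)
  obtain ⟨ε, ⟨hε1, hε2, hε3⟩, hε0⟩ := (hev.and self_mem_nhdsWithin).exists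
  replace hε0 : 0 < ε := hε0
  have hw : 0 ≤ 1 - ε := by linarith
  set v : Fin m → ℝ := 1 + ε • g with hv
  have hvi : ∀ i, v i = 1 + ε * g i := fun i => by simp [hv]
  have hstep : A1 *ᵥ v + (1 - ε) • (A0 *ᵥ v) + (1 - ε) ^ 2 • (Am *ᵥ v) ≤ (1 - ε) • v := by
    intro i
    have e1 := congrFun hg i
    have e2 := congrFun h.row_sum i
    have e3 := mul_nonpos_of_nonneg_of_nonpos hε0.le (hε1 i).le
    simp only [hv, mulVec_add, mulVec_smul, add_mulVec, Pi.add_apply, Pi.smul_apply, Pi.sub_apply,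
      Pi.one_apply, smul_eq_mul, mul_one] at e1 e2 e3 ⊢
    refine le_of_sub_nonpos (le_of_eq_of_le ?_ e3)
    linear_combination (1 - ε) * e2 + ε * e1
  have hGv := hGhat.mulVec_le h.symm (u := fun n => (1 - ε) ^ n • v)
    (fun n i => by
      simpa using mul_nonneg (pow_nonneg hw n) (by rw [hvi]; exact (hε2 i).le))
    (fun n => by
      have := smul_le_smul_of_nonneg_left hstep (pow_nonneg hw n)
      simp only [mulVec_smul, smul_add, smul_smul] at this ⊢
      simpa only [pow_add, pow_one] using this) 0
  -- At the minimum of `v`, `Ĝ 1 = 1` gives `v i ≤ (Ĝ v) i ≤ (1 - ε) v i`, impossible for `v i > 0`.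
  obtain ⟨i, -, hi⟩ := Finset.exists_min_image Finset.univ v ⟨⟨0, hm⟩, Finset.mem_univ _⟩
  have h1 : v i • (1 : Fin m → ℝ) ≤ v := fun j => by simpa using hi j (Finset.mem_univ j)
  have h2 := mulVec_mono hGhat.1 h1 i
  have h3 := hGv i
  rw [mulVec_smul, hG1] at h2
  simp at h2 h3
  have h4 := hε2 i
  rw [← hvi] at h4
  nlinarith

theorem ofReal_sum_le {ι : Type*} (s : Finset ι) (f : ι → ℝ) :
    ENNReal.ofReal (∑ i ∈ s, f i) ≤ ∑ i ∈ s, ENNReal.ofReal (f i) :=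
  Finset.le_sum_of_subadditive _ ENNReal.ofReal_zero.le (fun _ _ => ENNReal.ofReal_add_le) s f

/-- The level drops by at most one per step, so level zero is out of reach from level `n` within `k
< n` steps. -/
theorem one_le_survival (hP : IsRowStochastic (transition B Am A0 A1)) (i₁ : Fin m) {k n : ℕ}
    (hkn : k < n) (i : Fin m) : 1 ≤ survival (transition B Am A0 A1) (0, i₁) k (n, i) := by
  induction k generalizing n i with
  | zero => simp [survival]
  | succ k ih =>
    obtain ⟨n, rfl⟩ := Nat.exists_eq_add_of_lt hkn
    rw [survival, ← hP.tsum_ofReal (k + 1 + n + 1, i), ← tsum_ne_add _ (0, i₁)]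
    have hz : transition B Am A0 A1 (k + 1 + n + 1, i) (0, i₁) = 0 := by
      simp [transition]
    rw [hz, ENNReal.ofReal_zero, add_zero]
    refine ENNReal.tsum_le_tsum fun z => ?_
    obtain ⟨⟨l, j⟩, hz⟩ := z
    by_cases hl : k < l
    · exact le_mul_of_one_le_right zero_le (ih hl j)
    · have : transition B Am A0 A1 (k + 1 + n + 1, i) (l, j) = 0 := by
        simp only [transition, of_apply]
        rw [if_neg (by omega), if_neg (by omega), if_neg (by omega)]
      simp [this]

theorem level_le_meanHittingTime (hP : IsRowStochastic (transition B Am A0 A1)) (i₁ : Fin m)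
    (n : ℕ) (i : Fin m) :
    (n : ℝ≥0∞) ≤ meanHittingTime (transition B Am A0 A1) (0, i₁) (n, i) :=
  calc (n : ℝ≥0∞) = ∑ _k ∈ Finset.range n, 1 := by simp
    _ ≤ ∑ k ∈ Finset.range n, survival (transition B Am A0 A1) (0, i₁) k (n, i) :=
        Finset.sum_le_sum fun k hk => one_le_survival hP i₁ (Finset.mem_range.1 hk) i
    _ ≤ _ := ENNReal.sum_le_tsum _

/-- A QBD with nonnegative mean drift is not positive recurrent. -/
theorem not_isPositiveRecurrent (hm : 0 < m) (hP : IsRowStochastic (transition B Am A0 A1))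
    (hirr : (transition B Am A0 A1).IsIrreducible) {g : Fin m → ℝ} {δ : ℝ} (hδ : 0 ≤ δ)
    (hg : Am *ᵥ g + A0 *ᵥ g + A1 *ᵥ g + (A1 *ᵥ 1 - Am *ᵥ 1) = g + δ • 1) :
    ¬ IsPositiveRecurrent (transition B Am A0 A1) := by
  intro hpr
  have hT := isStochasticTriple_of_isRowStochastic hP
  set i₁ : Fin m := ⟨0, hm⟩
  obtain ⟨iM, -, hM⟩ := Finset.exists_max_image Finset.univ g ⟨i₁, Finset.mem_univ _⟩
  replace hM := fun i => hM i (Finset.mem_univ i)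
  -- Subtracting the maximum of `g` and truncating at zero makes `f` vanish on level zero and stay
  -- below the level, yet `f (1, iM) = 1`.
  set f : ℕ × Fin m → ℝ≥0∞ := fun x => ENNReal.ofReal (x.1 + g x.2 - g iM) with hf
  have hf0 : ∀ i, f (0, i) = 0 := fun i => ENNReal.ofReal_eq_zero.2 (by simpa using hM i)
  have hle : f ≤ meanHittingTime (transition B Am A0 A1) (0, i₁) := fun x => by
    refine le_trans ?_ (level_le_meanHittingTime hP i₁ x.1 x.2)
    rw [← ENNReal.ofReal_natCast]
    exact ENNReal.ofReal_le_ofReal (by linarith [hM x.2])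
  have hsub : f ≤ killed (transition B Am A0 A1) (0, i₁) f := by
    rintro ⟨n, i⟩
    have hk := killed_add_mul (P := transition B Am A0 A1) (y := (0, i₁)) f (n, i)
    rw [hf0, mul_zero, add_zero] at hk
    rcases n with _ | n
    · rw [hf0]; exact zero_le
    · rw [hk, tsum_transition_succ]
      have hreal : ((n + 1 : ℕ) : ℝ) + g i - g iM ≤
          ∑ j, (Am i j * ((n : ℝ) + g j - g iM) + A0 i j * (((n + 1 : ℕ) : ℝ) + g j - g iM) +
            A1 i j * (((n + 2 : ℕ) : ℝ) + g j - g iM)) := by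
        have e1 := congrFun hg i
        have e2 := congrFun hT.row_sum i
        simp only [mulVec, dotProduct, Pi.add_apply, Matrix.add_apply, Pi.smul_apply, Pi.sub_apply,
          Pi.one_apply, smul_eq_mul, mul_one, Finset.sum_add_distrib] at e1 e2
        simp only [mul_add, mul_sub, Finset.sum_add_distrib, Finset.sum_sub_distrib,
          ← Finset.sum_mul]
        push_cast
        linear_combination hδ - e1 - (n + 1 - g iM) * e2
      -- The positive part is subadditive, so truncation preserves subharmonicity.
      refine (ENNReal.ofReal_le_ofReal hreal).trans ((ofReal_sum_le _ _).trans ?_)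
      refine Finset.sum_le_sum fun j _ => ?_
      refine ENNReal.ofReal_add_le.trans (add_le_add (ENNReal.ofReal_add_le.trans
        (add_le_add ?_ ?_)) ?_)
      · rw [ENNReal.ofReal_mul (hT.nonneg₀ i j)]
      · rw [ENNReal.ofReal_mul (hT.nonneg₁ i j)]
      · rw [ENNReal.ofReal_mul (hT.nonneg₂ i j)]
  have hzero := eq_zero_of_le_meanHittingTime hsub hle (x := (1, iM))
    (hP.meanHittingTime_lt_top (hpr _).1 (hpr _).2 (reaches_of_isIrreducible hirr _ _))
  simp [hf] at hzero

end

end QBD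

namespace QBD
open Filter Topology Matrix

/-! ### Invertibility of `I - G Ĝ` and coefficients of `η` -/

section

variable {m : ℕ} {B Am A0 A1 G Ghat : Matrix (Fin m) (Fin m) ℝ}

theorem IsQBD.pos (h : IsQBD B Am A0 A1) : 0 < m := by
  obtain ⟨-, -, -, E, ⟨e, -⟩, -⟩ := h
  exact e.pos

/-- `1 - G Ĝ` is nonsingular for a QBD that is not null recurrent. -/
theorem IsQBD.isUnit_one_sub (h : IsQBD B Am A0 A1)
    (hnn : IsPositiveRecurrent (transition B Am A0 A1) ∨ IsTransient (transition B Am A0 A1))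
    (hG : IsMinNonnegSol Am A0 A1 G) (hGhat : IsMinNonnegSol A1 A0 Am Ghat) :
    IsUnit (1 - G * Ghat) := by
  obtain ⟨hP, hirr, hA, hF⟩ := id h
  have hT := isStochasticTriple_of_isRowStochastic hP
  have hD := hF.reaches hA
  rw [isUnit_iff_isUnit_det, isUnit_iff_ne_zero]
  intro hdet
  obtain ⟨x, hx0, hx⟩ := exists_mulVec_eq_zero_iff.2 hdet
  rw [sub_mulVec, one_mulVec, sub_eq_zero, ← mulVec_mulVec] at hx
  obtain ⟨h1, h2⟩ := mulVec_one_of_fixed hT hD hG hGhat hx0 hx.symm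
  rcases hnn with hpr | htr
  · obtain ⟨g, δ, hg⟩ := exists_poisson_solution h.pos hT hD (A1 *ᵥ 1 - Am *ᵥ 1)
    exact not_isPositiveRecurrent h.pos hP hirr (drift_nonneg h.pos hT hGhat h2 hg) hg hpr
  · exact not_isTransient h.pos hP hirr hG h1 htr

/-- An irreducible QBD has upward transitions. -/
theorem IsQBD.up_ne_zero (h : IsQBD B Am A0 A1) : A1 ≠ 0 := by
  rintro rfl
  -- Without `A₁` the level never increases, which irreducibility forbids.
  have hstay : ∀ x y, Reaches (transition B Am A0 0) x y → y.1 ≤ x.1 := by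
    intro x y hxy
    induction hxy with
    | refl => exact le_rfl
    | @tail a b _ hab ih =>
      refine le_trans ?_ ih
      by_contra hlt
      simp only [transition, of_apply] at hab
      rw [if_neg (show ¬ b.1 = a.1 by omega), if_neg (show ¬ b.1 + 1 = a.1 by omega)] at hab
      simp at hab
  have := hstay (0, ⟨0, h.pos⟩) (1, ⟨0, h.pos⟩) (reaches_of_isIrreducible h.2.1 _ _)
  simp at this

theorem toComplex_eq_mapMatrix (A : Matrix (Fin m) (Fin m) ℝ) :
    toComplex A = Complex.ofRealHom.mapMatrix A := rfl

theorem IsMinNonnegSol.toComplex_eq (hG : IsMinNonnegSol Am A0 A1 G) :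
    toComplex Am + (toComplex A0 - 1) * toComplex G + toComplex A1 * toComplex G ^ 2 = 0 := by
  have := congrArg Complex.ofRealHom.mapMatrix hG.2.1
  simp only [map_add, map_mul, map_sub, map_pow, map_one, map_zero] at this
  exact this

theorem coeff_eta_zero : (eta Am A0 A1).coeff 0 = toComplex Am := by
  simp [eta]

theorem coeff_eta_one : (eta Am A0 A1).coeff 1 = toComplex A0 - 1 := by
  simp [eta, Polynomial.coeff_C, Polynomial.coeff_X_pow, Polynomial.coeff_sub,
    Polynomial.coeff_one]

theorem coeff_eta_two : (eta Am A0 A1).coeff 2 = toComplex A1 := by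
  simp [eta, Polynomial.coeff_one, Polynomial.coeff_X_pow]

theorem degree_eta (h : A1 ≠ 0) : (eta Am A0 A1).degree = 2 := by
  have h1 : toComplex A1 ≠ 0 := by
    rw [toComplex_eq_mapMatrix]
    exact (map_ne_zero_iff _ (Matrix.map_injective Complex.ofReal_injective)).2 h
  rw [eta, show (Polynomial.C (toComplex Am) + Polynomial.C (toComplex A0 - 1) * Polynomial.X +
    Polynomial.C (toComplex A1) * Polynomial.X ^ 2) = (Polynomial.C (toComplex A1) *
    Polynomial.X ^ 2 + Polynomial.C (toComplex A0 - 1) * Polynomial.X +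
    Polynomial.C (toComplex Am)) by abel]
  exact Polynomial.degree_quadratic h1

end

theorem isNonsingular_of_mulVec_injective {ι κ : Type*} [Fintype ι] [Fintype κ] [DecidableEq ι]
    [DecidableEq κ] (hcard : Fintype.card ι = Fintype.card κ) {M : Matrix ι κ ℂ}
    (hM : ∀ c : κ → ℂ, M *ᵥ c = 0 → c = 0) : IsNonsingular M := by
  let e : ι ≃ κ := Fintype.equivOfCardEq hcard
  have hu : IsUnit (M.submatrix e.symm id) := by
    refine mulVec_injective_iff_isUnit.1 ((injective_iff_map_eq_zero
      (mulVecLin (M.submatrix e.symm id))).2 fun c hc => hM c (funext fun i => ?_))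
    have := congrFun hc (e i)
    simpa [mulVec, dotProduct] using this
  obtain ⟨u, hu⟩ := hu
  have hM' : M = (u : Matrix κ κ ℂ).submatrix e id := by
    rw [hu]
    ext i j
    simp
  refine ⟨((u⁻¹ : (Matrix κ κ ℂ)ˣ) : Matrix κ κ ℂ).submatrix id e, ?_, ?_⟩
  · rw [hM', submatrix_mul _ _ e id e Function.bijective_id |>.symm]
    simp
  · rw [hM', ← submatrix_mul _ _ id e id e.bijective]
    simp

/-! ### Nonsingularity of the pair matrix -/

section

variable {m p r : ℕ} {G Ghat : Matrix (Fin m) (Fin m) ℝ}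
  {L : Matrix (Fin m) (Fin p) ℂ} {K : Matrix (Fin m) (Fin r) ℂ}
  {V₁ : Matrix (Fin p) (Fin p) ℂ} {V₀ : Matrix (Fin r) (Fin r) ℂ}

theorem pairMatrix_two_mulVec (c : (Fin m ⊕ Fin p) ⊕ Fin r → ℂ) (k : Fin 2) (i : Fin m) :
    (pairMatrix 2 (fromCols 1 L) (fromBlocks (toComplex G) 0 0 V₁⁻¹) K V₀ *ᵥ c) (k, i) =
      ((fromCols (1 : Matrix (Fin m) (Fin m) ℂ) L * fromBlocks (toComplex G) 0 0 V₁⁻¹ ^ (k : ℕ)) *ᵥ (c ∘ Sum.inl) +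
        (K * V₀ ^ (1 - (k : ℕ))) *ᵥ (c ∘ Sum.inr)) i := by
  simp [pairMatrix, mulVec, dotProduct, Fintype.sum_sum_type]

theorem isNonsingular_pairMatrix (hpr : p + r = m) (hu : IsUnit (1 - G * Ghat))
    (hM : IsNonsingular (fromCols L K)) (hL : toComplex Ghat * L = L * V₁)
    (hK : toComplex Ghat * K = K * V₀) (hV₁ : IsUnit V₁) :
    IsNonsingular (pairMatrix 2 (fromCols 1 L) (fromBlocks (toComplex G) 0 0 V₁⁻¹) K V₀) := by
  have hdet : IsUnit V₁.det := (isUnit_iff_isUnit_det _).1 hV₁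
  refine isNonsingular_of_mulVec_injective
    (by simp only [Fintype.card_prod, Fintype.card_sum, Fintype.card_fin]; omega) fun c hc => ?_
  obtain ⟨a, b, d, rfl⟩ : ∃ a b d, c = Sum.elim (Sum.elim a b) d :=
    ⟨c ∘ Sum.inl ∘ Sum.inl, c ∘ Sum.inl ∘ Sum.inr, c ∘ Sum.inr, by ext ((_ | _) | _) <;> rfl⟩
  have h0 : a + L *ᵥ b + K *ᵥ (V₀ *ᵥ d) = 0 := funext fun i => by
    have := congrFun hc (0, i)
    rw [pairMatrix_two_mulVec] at this
    simpa [fromCols_mulVec] using this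
  have h1 : toComplex G *ᵥ a + L *ᵥ (V₁⁻¹ *ᵥ b) + K *ᵥ d = 0 := funext fun i => by
    have := congrFun hc (1, i)
    rw [pairMatrix_two_mulVec] at this
    simpa [fromCols_mulVec, fromCols_mul_fromBlocks] using this
  set b' := V₁⁻¹ *ᵥ b with hb'
  have hb : b = V₁ *ᵥ b' := by rw [hb', mulVec_mulVec, mul_nonsing_inv _ hdet, one_mulVec]
  -- With this `e`, the first block row reads `a = -Ĝ e` and the second `G a + e = 0`, whence `(I -
  -- G Ĝ) e = 0`. Nonsingularity of `[L | K]` then recovers `b'` and `d` from `e = 0`.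
  set e := L *ᵥ b' + K *ᵥ d with he
  have hGe : toComplex Ghat *ᵥ e = L *ᵥ b + K *ᵥ (V₀ *ᵥ d) := by
    rw [he, mulVec_add, mulVec_mulVec _ _ L, mulVec_mulVec _ _ K, hL, hK, hb, ← mulVec_mulVec,
      ← mulVec_mulVec]
  have ha : a = -(toComplex Ghat *ᵥ e) := by
    rw [hGe, eq_neg_iff_add_eq_zero, ← add_assoc, h0]
  have he0 : e = 0 := by
    have huC : IsUnit (1 - toComplex G * toComplex Ghat) := by
      have := hu.map Complex.ofRealHom.mapMatrix
      rwa [map_sub, map_one, map_mul] at this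
    refine mulVec_injective_iff_isUnit.2 huC ?_
    rw [mulVec_zero, sub_mulVec, one_mulVec, ← mulVec_mulVec]
    rw [add_assoc, ← he, ha, mulVec_neg] at h1
    rw [← h1]
    abel
  have ha0 : a = 0 := by rw [ha, he0, mulVec_zero, neg_zero]
  obtain ⟨N, -, hN⟩ := hM
  have hbd : Sum.elim b' d = 0 := by
    rw [← one_mulVec (Sum.elim b' d), ← hN, ← mulVec_mulVec, fromCols_mulVec]
    simp only [Sum.elim_comp_inl, Sum.elim_comp_inr]
    rw [← he, he0, mulVec_zero]
  have hb'0 : b' = 0 := funext fun i => congrFun hbd (Sum.inl i)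
  have hd0 : d = 0 := funext fun i => congrFun hbd (Sum.inr i)
  rw [ha0, hb, hb'0, hd0, mulVec_zero]
  ext ((_ | _) | _) <;> rfl

end

end QBD

theorem lemma3p2 {m p r : ℕ} (hpr : p + r = m)
    (B Am A0 A1 G Ghat : Matrix (Fin m) (Fin m) ℝ)
    (hQBD : QBD.IsQBD B Am A0 A1)
    (hnn : QBD.IsPositiveRecurrent (QBD.transition B Am A0 A1) ∨
      QBD.IsTransient (QBD.transition B Am A0 A1))
    (hG : QBD.IsMinNonnegSol Am A0 A1 G)
    (hGhat : QBD.IsMinNonnegSol A1 A0 Am Ghat)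
    (L : Matrix (Fin m) (Fin p) ℂ) (K : Matrix (Fin m) (Fin r) ℂ)
    (V₁ : Matrix (Fin p) (Fin p) ℂ) (V₀ : Matrix (Fin r) (Fin r) ℂ)
    (hM : QBD.IsNonsingular (Matrix.fromCols L K))
    (hJ : QBD.toComplex Ghat * Matrix.fromCols L K =
      Matrix.fromCols L K * Matrix.fromBlocks V₁ 0 0 V₀)
    (hV₁ : IsUnit V₁)
    (hV₀ : spectralRadius ℂ V₀ = 0) :
    QBD.IsDecomposablePair 2 (QBD.eta Am A0 A1)
      (Matrix.fromCols (Matrix.fromCols (1 : Matrix (Fin m) (Fin m) ℂ) L) K)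
      (Matrix.fromBlocks (Matrix.fromBlocks (QBD.toComplex G) 0 0 V₁⁻¹) 0 0 V₀) := by
  have hdet : IsUnit V₁.det := (Matrix.isUnit_iff_isUnit_det _).1 hV₁
  rw [Matrix.mul_fromCols, Matrix.fromCols_mul_fromBlocks] at hJ
  simp only [Matrix.mul_zero, add_zero, zero_add] at hJ
  obtain ⟨hL, hK⟩ := (Matrix.fromCols_ext_iff _ _ _ _).1 hJ
  have hGhatC := hGhat.toComplex_eq
  refine ⟨QBD.degree_eta hQBD.up_ne_zero,
    by simp only [Fintype.card_sum, Fintype.card_fin]; omega,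
    Matrix.fromCols 1 L, K, Matrix.fromBlocks (QBD.toComplex G) 0 0 V₁⁻¹, V₀, rfl, rfl,
    QBD.isNonsingular_pairMatrix hpr (hQBD.isUnit_one_sub hnn hG hGhat) hM hL hK hV₁, ?_, ?_⟩
  · have hLV : L = QBD.toComplex Ghat * L * V₁⁻¹ := by
      rw [hL, Matrix.mul_assoc, Matrix.mul_nonsing_inv _ hdet, Matrix.mul_one]
    have hL1 : L * V₁⁻¹ * V₁⁻¹ = L * (V₁⁻¹ * V₁⁻¹) := Matrix.mul_assoc _ _ _
    -- Multiplying by `L V₁⁻²` reverses the order of the coefficients: `Ĝ` acts on `L` as `V₁`, so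
    -- each factor `Ĝ` cancels one `V₁⁻¹`.
    have hkey : QBD.toComplex Am * L + (QBD.toComplex A0 - 1) * (L * V₁⁻¹) +
        QBD.toComplex A1 * (L * (V₁⁻¹ * V₁⁻¹)) = 0 := by
      have h1 : QBD.toComplex Ghat * (L * (V₁⁻¹ * V₁⁻¹)) = L * V₁⁻¹ := by
        rw [← Matrix.mul_assoc, ← Matrix.mul_assoc, ← hLV]
      have h2 : QBD.toComplex Ghat * (L * V₁⁻¹) = L := by rw [← Matrix.mul_assoc, ← hLV]
      have h := congrArg (· * (L * (V₁⁻¹ * V₁⁻¹))) hGhatC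
      simp only [pow_two, Matrix.add_mul, Matrix.mul_assoc, h1, h2, Matrix.zero_mul] at h ⊢
      rw [← h]
      abel
    simp only [Finset.sum_range_succ, Finset.sum_range_zero, zero_add, QBD.coeff_eta_zero,
      QBD.coeff_eta_one, QBD.coeff_eta_two, pow_zero, pow_one, pow_two, Matrix.mul_one]
    rw [Matrix.fromBlocks_multiply]
    simp only [Matrix.mul_fromCols, Matrix.fromCols_mul_fromBlocks, Matrix.mul_one,
      Matrix.mul_zero, Matrix.zero_mul, add_zero, zero_add, Matrix.mul_assoc]
    have hGC := hG.toComplex_eq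
    rw [pow_two] at hGC
    ext i (j | j)
    · exact congrFun (congrFun hGC i) j
    · exact congrFun (congrFun hkey i) j
  · have h := congrArg (· * K) hGhatC
    have hK2 : QBD.toComplex Ghat * (K * V₀) = K * (V₀ * V₀) := by
      rw [← Matrix.mul_assoc, hK, Matrix.mul_assoc]
    simp only [pow_two, Matrix.add_mul, Matrix.mul_assoc, hK, hK2, Matrix.zero_mul] at h
    simp only [Finset.sum_range_succ, Finset.sum_range_zero, zero_add, QBD.coeff_eta_zero,
      QBD.coeff_eta_one, QBD.coeff_eta_two, pow_zero, pow_one, pow_two, Matrix.mul_one,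
      Nat.sub_zero, Nat.sub_self, Nat.reduceSub, Matrix.mul_assoc]
    rw [← h]
    abel
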